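/- \textbf{Setting.} A job is an absorbing continuous-time Markov process with right-continuous paths in a metrizable space $\mathbb{X}\cup\{x_{\mathsf{done}}\}$, with absorbing state $x_{\mathsf{done}}\notin\mathbb{X}$, and with the strong Markov property at stopping times of the right-continuous natural filtration. The set $\mathbb{X}_{\mathsf P}\subseteq\mathbb{X}$ of preemptible states is measurable, and each state $x\in\mathbb{X}$ has a holding cost $\mathrm{hold}(x)>0$, continuous in $x\in\mathbb{X}$; put $\mathrm{hold}(x_{\mathsf{done}})=0$. A \emph{give-up set} is a set $Y\subseteq\mathbb{X}_{\mathsf P}$ such that, for every initial distribution, the first entry time of the job to $Y\cup\{x_{\mathsf{done}}\}$ is a stopping time of the augmented filtration and the job is a.s. in $Y\cup\{x_{\mathsf{done}}\}$ at that time if it is finite. For a job that starts in $x$, let $\mathrm{Serve}(x,Y)$ be the distribution of this time, $\mathrm{serve}(x,Y)$ its mean, and $\mathrm{hold}(x,Y)$ the mean holding cost of the job's state at this time. The Gittins game with penalty parameter $r\ge0$ has the cost $\mathrm{game}(x,r,Y)=\mathrm{serve}(x,Y)+r\,\mathrm{hold}(x,Y)$ and the cost-to-go function $\mathrm{game}(x,r)=\inf_Y\mathrm{game}(x,r,Y)$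 over give-up sets $Y$. Let $Y^*(r)=\{x\in\mathbb{X}_{\mathsf P}:\mathrm{game}(x,r)=r\,\mathrm{hold}(x)\}$, and write $\mathrm{Serve}(x,r),\mathrm{serve}(x,r),\mathrm{hold}(x,r)$ for $Y=Y^*(r)$. Assume that the mean remaining service time $\mathrm{serve}(x,\emptyset)$ is finite for all $x\in\mathbb{X}_{\mathsf P}$, and that optimal stopping of the Gittins game is possible: $\mathbb{X}_{\mathsf P}$ and all $Y^*(r)$, $r\ge 0$, are give-up sets, and for each $r\ge0$ there is a give-up set $Y$ with $\mathrm{game}(x,r,Y)=\mathrm{game}(x,r)$ for all $x\in\mathbb{X}_{\mathsf P}$. In the queue, batches of jobs (i.i.d. finite lists of preemptible initial states, with arbitrary dependence inside a batch, and with mean batch size $\mathbb{E}[B]\in(0,\infty)$) arrive to an initially empty system according to an independent Poisson process of rate $\lambda/\mathbb{E}[B]$, $\lambda>0$; the load $\lambda\,\mathbb{E}[S]$, where $S$ is the service time of a job, is less than $1$. Given their initial states, jobs evolve independently of each other and of the arrival times as functions of their attained service. A scheduling policy divides a server of rate at most $1$ among the jobs in the system, without preempting a job that is in a nonpreemptible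 state; it is nonclairvoyant if its decisions depend only on the current and past system states (the list of the states of the jobs in the system). Let $(X_1,\dots,X_N)$ have the equilibrium (limiting) distribution of the system state, let $H_{\mathsf P}=\sum_{i=1}^N\mathbf 1(X_i\in\mathbb{X}_{\mathsf P})\,\mathrm{hold}(X_i)$ be the preemptible holding cost, and let $W_{\mathsf P}(r)=\sum_{i=1}^N\mathbf 1(X_i\in\mathbb{X}_{\mathsf P})\,\mathrm{Serve}(X_i,r)$ be the preemptible $r$-work, where, given $(X_1,\dots,X_N)$, the terms are independent random variables with the distributions $\mathrm{Serve}(X_i,r)$. \textbf{Theorem.} \begin{enumerate} \item For every $x\in\mathbb{X}_{\mathsf P}$, the function $r\mapsto\mathrm{game}(x,r)$ is concave on $[0,\infty)$; for almost every $r>0$ it is differentiable at $r$ with derivative $\mathrm{hold}(x,r)$; and \[\mathrm{hold}(x)=\int_0^\infty\frac{\mathrm{serve}(x,r)}{r^2}\,dr.\] \item Under every nonclairvoyant policy for which the equilibrium distribution exists, \[\mathbb{E}[H_{\mathsf P}]=\int_0^\infty\frac{\mathbb{E}[W_{\mathsf P}(r)]}{r^2}\,dr,\] as an identity in $[0,\infty]$.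 \end{enumerate} -/

import Mathlib

open MeasureTheory ProbabilityTheory Set Filter Topology
open scoped NNReal ENNReal

noncomputable section

/-! ### Right-continuous paths -/

/-- Right-continuous paths `[0, ∞) → E`, with the σ-algebra generated by the coordinates. -/
abbrev JobPath (E : Type*) [TopologicalSpace E] : Type _ :=
  {ω : ℝ≥0 → E // ∀ t, ContinuousWithinAt ω (Ici t) t}

namespace JobPath

variable {E : Type*} [TopologicalSpace E]

/-- The path seen from time `t` on: `s ↦ ω (t + s)`. -/
def shift (t : ℝ≥0) (ω : JobPath E) : JobPath E :=
  ⟨fun s => ω.1 (t + s), fun s =>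
    (ω.2 (t + s)).comp (f := fun u : ℝ≥0 => t + u)
      (continuous_const.add continuous_id).continuousWithinAt
      (fun u (hu : s ≤ u) => by
        change t + s ≤ t + u
        gcongr)⟩

/-- The σ-algebra of what can be seen of the path up to time `t`. -/
abbrev past [MeasurableSpace E] (t : ℝ≥0) : MeasurableSpace (JobPath E) :=
  ⨆ s : ℝ≥0, ⨆ _ : s ≤ t, MeasurableSpace.comap (fun ω : JobPath E => ω.1 s) inferInstance

/-- Stopping times of the right-continuous natural filtration (optional times). -/
def IsOptionalTime [MeasurableSpace E] (T : JobPath E → ℝ≥0∞) : Prop :=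
  ∀ t : ℝ≥0, MeasurableSet[past t] {ω | T ω < t}

end JobPath

/-! ### Jobs as absorbing strong Markov processes -/

/-- The job model. The points of `E` other than `done` are the job states; `done` is the final
state. `law x` is the distribution of the path of a job in service that starts in state `x`. -/
structure JobModel (E : Type*) [TopologicalSpace E] [TopologicalSpace.MetrizableSpace E]
    [MeasurableSpace E] [BorelSpace E] where
  done : E
  law : Kernel E (JobPath E)
  isMarkovKernel_law : IsMarkovKernel law
  start_eq : ∀ x, ∀ᵐ ω ∂(law x), ω.1 0 = x
  absorbing : ∀ x, ∀ᵐ ω ∂(law x), ∀ s t : ℝ≥0, s ≤ t → ω.1 s = done → ω.1 t = done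
  strongMarkov : ∀ (x : E) (T : JobPath E → ℝ≥0∞), JobPath.IsOptionalTime T →
    ∀ B : Set (JobPath E), MeasurableSet B →
      law x {ω | T ω < ∞ ∧ JobPath.shift (T ω).toNNReal ω ∈ B} =
        ∫⁻ ω in {ω | T ω < ∞}, law (ω.1 (T ω).toNNReal) B ∂(law x)
  preemptible : Set E
  measurableSet_preemptible : MeasurableSet preemptible
  done_notMem : done ∉ preemptible
  holdCost : E → ℝ≥0
  holdCost_done : holdCost done = 0
  holdCost_pos : ∀ x, x ≠ done → 0 < holdCost x
  continuousOn_holdCost : ContinuousOn holdCost {done}ᶜ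

namespace JobModel

variable {E : Type*} [TopologicalSpace E] [TopologicalSpace.MetrizableSpace E]
  [MeasurableSpace E] [BorelSpace E] (M : JobModel E)

/-- The amount of service after which the job first is in `Y ∪ {done}`. -/
def entry (Y : Set E) (ω : JobPath E) : ℝ≥0∞ :=
  ⨅ (t : ℝ≥0) (_ : ω.1 t ∈ insert M.done Y), (t : ℝ≥0∞)

/-- The holding cost of the job when it first is in `Y ∪ {done}`. -/
def holdAtEntry (Y : Set E) (ω : JobPath E) : ℝ≥0∞ :=
  if M.entry Y ω < ∞ then (M.holdCost (ω.1 (M.entry Y ω).toNNReal) : ℝ≥0∞) else 0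

/-- The give-up sets: sets of preemptible states for which "stop at the first entry" makes sense,
i.e. the first entry time is, for every initial distribution, almost surely equal to an optional
time (a stopping time of the augmented filtration), and the entry does happen at that time. -/
structure IsGiveUpSet (Y : Set E) : Prop where
  subset : Y ⊆ M.preemptible
  isStopping : ∀ μ : Measure E, IsProbabilityMeasure μ →
    ∃ T : JobPath E → ℝ≥0∞, JobPath.IsOptionalTime T ∧ M.entry Y =ᵐ[μ.bind M.law] T
  attained : ∀ μ : Measure E, IsProbabilityMeasure μ → ∀ᵐ ω ∂(μ.bind M.law),
    M.entry Y ω < ∞ → ω.1 (M.entry Y ω).toNNReal ∈ insert M.done Y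

/-- The distribution of the service that a job in state `x` needs to first enter
`Y ∪ {done}`. -/
def serveDist (x : E) (Y : Set E) : Measure ℝ≥0∞ := (M.law x).map (M.entry Y)

/-- The mean service that a job in state `x` needs to first enter `Y ∪ {done}`. -/
def serve (x : E) (Y : Set E) : ℝ≥0∞ := ∫⁻ ω, M.entry Y ω ∂(M.law x)

/-- The mean holding cost at first entry to `Y ∪ {done}` of a job that starts in state `x`. -/
def hold (x : E) (Y : Set E) : ℝ≥0∞ := ∫⁻ ω, M.holdAtEntry Y ω ∂(M.law x)

/-- The Gittins game: cost of the give-up set `Y`, with penalty parameter `r`. -/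
def gameCost (x : E) (r : ℝ≥0) (Y : Set E) : ℝ≥0∞ := M.serve x Y + r * M.hold x Y

/-- The cost-to-go function of the Gittins game. -/
def game (x : E) (r : ℝ≥0) : ℝ≥0∞ := ⨅ (Y : Set E) (_ : M.IsGiveUpSet Y), M.gameCost x r Y

/-- The states in which it is optimal to give up immediately. -/
def optSet (r : ℝ≥0) : Set E := {x | x ∈ M.preemptible ∧ M.game x r = r * M.holdCost x}

/-- The setting of optimal stopping: "give up as soon as possible" and "give up as soon as giving
up immediately is optimal" are strategies with well-defined entry times, and for each penalty
parameter some give-up set is optimal, whatever the preemptible starting state. -/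
structure GameSolvable : Prop where
  isGiveUpSet_preemptible : M.IsGiveUpSet M.preemptible
  isGiveUpSet_optSet : ∀ r, M.IsGiveUpSet (M.optSet r)
  exists_optimal : ∀ r, ∃ Y, M.IsGiveUpSet Y ∧ ∀ x ∈ M.preemptible, M.gameCost x r Y = M.game x r

open scoped Classical in
/-- The distribution of the preemptible `r`-work of a system in state `(x₁, …, xₙ)`: the sum of
independent random variables, the `i`th one with the distribution of the service that a job in
state `xᵢ` needs to first enter `optSet r ∪ {done}` if `xᵢ` is preemptible, and zero otherwise. -/
def preemptibleWorkDist (r : ℝ≥0) : List E → Measure ℝ≥0∞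
  | [] => Measure.dirac 0
  | x :: l => (if x ∈ M.preemptible then M.serveDist x (M.optSet r) else Measure.dirac 0).conv
      (preemptibleWorkDist r l)

open scoped Classical in
/-- The preemptible holding cost of a system in state `(x₁, …, xₙ)`. -/
def preemptibleHoldCost (l : List E) : ℝ≥0∞ :=
  (l.map fun x => if x ∈ M.preemptible then (M.holdCost x : ℝ≥0∞) else 0).sum

end JobModel

/-! ### Lists of states -/

/-- The σ-algebra of finite lists: the disjoint union of the product σ-algebras on `Eⁿ`. -/
instance List.instMeasurableSpaceStates {E : Type*} [MeasurableSpace E] :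
    MeasurableSpace (List E) :=
  ⨅ n : ℕ, MeasurableSpace.map (fun v : Fin n → E => List.ofFn v) inferInstance

/-! ### The queue -/

/-- The parameters of the queue: the job model, the arrival rate of jobs, and the distribution of
a batch, a list of preemptible initial states. -/
structure QueueModel (E : Type*) [TopologicalSpace E] [TopologicalSpace.MetrizableSpace E]
    [MeasurableSpace E] [BorelSpace E] where
  job : JobModel E
  rate : ℝ
  rate_pos : 0 < rate
  batchLaw : Measure (List E)
  isProbabilityMeasure_batchLaw : IsProbabilityMeasure batchLaw
  batch_preemptible : ∀ᵐ l ∂batchLaw, ∀ x ∈ l, x ∈ job.preemptible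
  meanBatch_pos : 0 < ∫⁻ l, (l.length : ℝ≥0∞) ∂batchLaw
  meanBatch_lt_top : ∫⁻ l, (l.length : ℝ≥0∞) ∂batchLaw < ∞

namespace QueueModel

variable {E : Type*} [TopologicalSpace E] [TopologicalSpace.MetrizableSpace E]
  [MeasurableSpace E] [BorelSpace E] (Q : QueueModel E)

/-- The mean number of jobs of a batch. -/
def meanBatch : ℝ≥0∞ := ∫⁻ l, (l.length : ℝ≥0∞) ∂Q.batchLaw

/-- The mean service time of a job; the initial state is that of a uniformly chosen job of a
length-biased batch, hence the mean over all jobs of a batch divided by the mean batch size. -/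
def meanService : ℝ≥0∞ :=
  (∫⁻ l, (l.map fun x => Q.job.serve x ∅).sum ∂Q.batchLaw) / Q.meanBatch

/-- The load. -/
def load : ℝ≥0∞ := ENNReal.ofReal Q.rate * Q.meanService

/-- The rate of the Poisson process of batch arrivals. -/
def batchRate : ℝ := Q.rate / Q.meanBatch.toReal

end QueueModel

/-- A scheduling policy: `share t H i` is the share of the server that the `i`th job in the system
gets at time `t`, when `H` is the evolution of the system state. -/
structure SchedulingPolicy (E : Type*) where
  share : ℝ≥0 → (ℝ≥0 → List E) → ℕ → ℝ≥0
  share_le : ∀ t H, ∑' i, (share t H i : ℝ≥0∞) ≤ 1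

/-- Decisions are based only on the current and past system states. -/
def SchedulingPolicy.IsNonclairvoyant {E : Type*} (π : SchedulingPolicy E) : Prop :=
  ∀ (t : ℝ≥0) (H H' : ℝ≥0 → List E), (∀ s ≤ t, H s = H' s) → π.share t H = π.share t H'

/-- The random evolution of the queue, empty before time `0`. The job `(n, i)` is the `i`th job of
the `n`th batch. `gap n` is the time between the batches `n - 1` and `n`; `path n i` is the path
of the job `(n, i)` as a function of its attained service; `attained k t` is the service that the
job `k` has got by time `t`. -/
structure QueueEvolution (E Ω : Type*) [TopologicalSpace E] where
  gap : ℕ → Ω → ℝ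
  batch : ℕ → Ω → List E
  path : ℕ × ℕ → Ω → JobPath E
  attained : ℕ × ℕ → ℝ≥0 → Ω → ℝ≥0

namespace QueueEvolution

variable {E Ω : Type*} [TopologicalSpace E] [TopologicalSpace.MetrizableSpace E]
  [MeasurableSpace E] [BorelSpace E] (R : QueueEvolution E Ω)

/-- The arrival time of the `n`th batch. -/
def arrivalTime (n : ℕ) (ω : Ω) : ℝ := ∑ m ∈ Finset.range (n + 1), R.gap m ω

/-- The initial state of the job `k` (and `done` if the batch has no such job). -/
def initialState (M : JobModel E) (k : ℕ × ℕ) (ω : Ω) : E := (R.batch k.1 ω).getD k.2 M.done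

/-- The state of the job `k` at time `t`. -/
def jobState (k : ℕ × ℕ) (t : ℝ≥0) (ω : Ω) : E := (R.path k ω).1 (R.attained k t ω)

/-- The jobs that have arrived by time `t`, in order of arrival. -/
def arrivedJobs (t : ℝ≥0) (ω : Ω) : List (ℕ × ℕ) :=
  (List.range {n | R.arrivalTime n ω ≤ t}.ncard).flatMap fun n =>
    (List.range (R.batch n ω).length).map fun i => (n, i)

open scoped Classical in
/-- The jobs in the system at time `t`: those that have arrived and are not completed. -/
def jobs (M : JobModel E) (t : ℝ≥0) (ω : Ω) : List (ℕ × ℕ) :=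
  (R.arrivedJobs t ω).filter fun k => R.jobState k t ω ≠ M.done

/-- The system state at time `t`: the list of the states of the jobs in the system. -/
def state (M : JobModel E) (t : ℝ≥0) (ω : Ω) : List E :=
  (R.jobs M t ω).map fun k => R.jobState k t ω

open scoped Classical in
/-- The rate at which the job `k` is served at time `t` under the policy `π`. -/
def serviceRate (M : JobModel E) (π : SchedulingPolicy E) (k : ℕ × ℕ) (t : ℝ≥0) (ω : Ω) : ℝ≥0 :=
  if k ∈ R.jobs M t ω then
    π.share t (fun s => R.state M s ω) ((R.jobs M t ω).idxOf k) else 0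

/-- `R` is an evolution of the queue `Q` under the policy `π`. -/
structure IsEvolutionUnder [MeasurableSpace Ω] (Q : QueueModel E) (π : SchedulingPolicy E)
    (P : Measure Ω) : Prop where
  measurable_gap : ∀ n, Measurable (R.gap n)
  measurable_batch : ∀ n, Measurable (R.batch n)
  measurable_path : ∀ k, Measurable (R.path k)
  /-- Batches arrive according to a Poisson process. -/
  gap_law : ∀ n, P.map (R.gap n) = expMeasure Q.batchRate
  gap_indep : iIndepFun R.gap P
  /-- The batches are independent of each other and of the arrival times. -/
  batch_law : ∀ n, P.map (R.batch n) = Q.batchLaw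
  batch_indep : iIndepFun R.batch P
  gap_batch_indep : IndepFun (fun ω n => R.gap n ω) (fun ω n => R.batch n ω) P
  /-- Given arrival times and batches, the paths of the jobs are independent of each other, each
  of them distributed according to the job model. -/
  path_law : ∀ A : Set ((ℕ → ℝ) × (ℕ → List E)), MeasurableSet A →
    ∀ (F : Finset (ℕ × ℕ)) (B : ℕ × ℕ → Set (JobPath E)), (∀ k, MeasurableSet (B k)) →
      P {ω | ((fun n => R.gap n ω), (fun n => R.batch n ω)) ∈ A ∧ ∀ k ∈ F, R.path k ω ∈ B k} =
        ∫⁻ ω in {ω | ((fun n => R.gap n ω), (fun n => R.batch n ω)) ∈ A},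
          ∏ k ∈ F, Q.job.law (R.initialState Q.job k ω) (B k) ∂P
  /-- Jobs are served as the policy prescribes. -/
  measurable_serviceRate : ∀ᵐ ω ∂P, ∀ k, Measurable fun t => R.serviceRate Q.job π k t ω
  attained_eq : ∀ᵐ ω ∂P, ∀ k t, (R.attained k t ω : ℝ≥0∞) =
    ∫⁻ s in Icc (0 : ℝ) t, (R.serviceRate Q.job π k s.toNNReal ω : ℝ≥0∞)
  /-- A job in a nonpreemptible state is not preempted. -/
  nonpreemptible : ∀ᵐ ω ∂P, ∀ t, ∀ k ∈ R.jobs Q.job t ω,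
    R.jobState k t ω ∉ Q.job.preemptible → R.serviceRate Q.job π k t ω = 1
  aemeasurable_state : ∀ t, AEMeasurable (R.state Q.job t) P

/-- `ν` is the equilibrium (limiting) distribution of the system state. -/
def IsEquilibrium [MeasurableSpace Ω] (M : JobModel E) (P : Measure Ω)
    (ν : Measure (List E)) : Prop :=
  ∀ A : Set (List E), MeasurableSet A →
    Tendsto (fun t : ℝ≥0 => P {ω | R.state M t ω ∈ A}) atTop (𝓝 (ν A))

end QueueEvolution

end

/-! ### Measurability on the space of right-continuous paths -/

namespace JobPath

variable {E : Type*} [TopologicalSpace E] [MeasurableSpace E]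

/-! For fixed `x`, the function `game x ·` is an infimum of affine functions of `r`, one for each
give-up set, hence concave. The strong Markov property shows that `optSet r` attains the infimum
(`gameCost_optSet`). So the line `u ↦ serve + u * hold` of `optSet r` supports `game x ·` from above
at `r`, and its slope is the derivative wherever there is one.

Consequently `game x r / r` has derivative `-serve / r ^ 2` almost everywhere, and it is locally
Lipschitz, so the integral is its limit at `0` minus its limit at `∞`
(`lintegral_Ioi_div_sq_of_support`). The limit at `∞` is `0`, because never giving up bounds the
game by `serve x ∅`. The limit at `0` is `holdCost x`: as `r` decreases to `0` the entry time to
`optSet r` tends to `0`, and paths are right-continuous (`tendsto_hold_optSet`).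

The mean work of a list of states is the sum of the mean works of its entries, so the queue identity
holds list by list. Tonelli's theorem averages it over the equilibrium law. This needs joint
measurability in the list and `r`, which comes from monotonicity in `r`
(`aemeasurable_uncurry_of_monotone`). -/

theorem measurable_coord (t : ℝ≥0) : Measurable fun ω : JobPath E => ω.1 t :=
  (measurable_pi_apply t).comp measurable_subtype_coe

theorem past_le (t : ℝ≥0) : past t ≤ (inferInstance : MeasurableSpace (JobPath E)) :=
  iSup₂_le fun s _ => (measurable_coord s).comap_le

theorem IsOptionalTime.measurable {T : JobPath E → ℝ≥0∞} (hT : IsOptionalTime T) :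
    Measurable T := by
  refine measurable_of_Iio fun a => ?_
  have h : T ⁻¹' Iio a = ⋃ q : ℚ, ⋃ _ : ((q : ℝ).toNNReal : ℝ≥0∞) ≤ a,
      {ω | T ω < ((q : ℝ).toNNReal : ℝ≥0∞)} := by
    ext ω
    simp only [mem_preimage, mem_Iio, mem_iUnion, mem_ofPred_eq, exists_prop]
    refine ⟨fun h => ?_, fun ⟨q, hq, h⟩ => h.trans_le hq⟩
    obtain ⟨q, -, h1, h2⟩ := ENNReal.lt_iff_exists_rat_btwn.1 h
    exact ⟨q, h2.le, h1⟩
  rw [h]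
  exact MeasurableSet.iUnion fun q => MeasurableSet.iUnion fun _ => past_le _ _ (hT _)

variable [TopologicalSpace.MetrizableSpace E] [BorelSpace E]

/-- Multiples of `1 / (n + 1)` just above `τ` take countably many values, so evaluation there is
measurable; right continuity passes to the limit. -/
theorem measurable_eval {τ : JobPath E → ℝ≥0} (hτ : Measurable τ) :
    Measurable fun ω : JobPath E => ω.1 (τ ω) := by
  have hlim (t : ℝ≥0) : Tendsto (fun n : ℕ => (((⌊(n + 1) * t⌋₊ + 1 : ℕ) : ℝ≥0) / (n + 1)))
      atTop (𝓝[Ici t] t) := by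
    refine tendsto_nhdsWithin_iff.2 ⟨?_, Eventually.of_forall fun n => ?_⟩
    · have h1 : Tendsto (fun n : ℕ => t + 1 / ((n : ℝ≥0) + 1)) atTop (𝓝 (t + 0)) :=
        tendsto_const_nhds.add tendsto_one_div_add_atTop_nhds_zero_nat
      rw [add_zero] at h1
      refine tendsto_of_tendsto_of_tendsto_of_le_of_le tendsto_const_nhds h1 (fun n => ?_)
        fun n => ?_
      · change t ≤ _
        rw [le_div_iff₀ (by positivity), mul_comm]
        exact_mod_cast (Nat.lt_floor_add_one ((n + 1) * t)).le
      · change _ / ((n : ℝ≥0) + 1) ≤ _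
        rw [div_le_iff₀ (by positivity), add_mul t,
          one_div_mul_cancel (by positivity : (n : ℝ≥0) + 1 ≠ 0), mul_comm t]
        push_cast
        gcongr
        exact Nat.floor_le (by positivity)
    · rw [mem_Ici, le_div_iff₀ (by positivity), mul_comm]
      exact_mod_cast (Nat.lt_floor_add_one ((n + 1) * t)).le
  refine measurable_of_tendsto_metrizable
    (f := fun n ω => ω.1 (((⌊(n + 1) * τ ω⌋₊ + 1 : ℕ) : ℝ≥0) / (n + 1))) (fun n => ?_)
    (tendsto_pi_nhds.2 fun ω => (ω.2 (τ ω)).tendsto.comp (hlim (τ ω)))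
  have h : Measurable fun p : JobPath E × ℕ => p.1.1 (((p.2 + 1 : ℕ) : ℝ≥0) / (n + 1)) :=
    measurable_from_prod_countable_left fun k =>
      measurable_coord (((k + 1 : ℕ) : ℝ≥0) / (n + 1))
  exact h.comp (measurable_id.prodMk (Nat.measurable_floor.comp (hτ.const_mul _)))

theorem measurable_shift {τ : JobPath E → ℝ≥0} (hτ : Measurable τ) :
    Measurable fun ω : JobPath E => shift (τ ω) ω :=
  Measurable.subtype_mk (measurable_pi_lambda _ fun s => measurable_eval (hτ.add_const s))

end JobPath

/-! ### The strong Markov property and the cost of a give-up set -/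

namespace JobModel

variable {E : Type*} [TopologicalSpace E] [TopologicalSpace.MetrizableSpace E]
  [MeasurableSpace E] [BorelSpace E] {M : JobModel E}

instance : IsMarkovKernel M.law := M.isMarkovKernel_law

theorem measurable_holdCost : Measurable M.holdCost := by
  classical
  simpa using (continuousOn_singleton M.holdCost M.done).measurable_piecewise
    M.continuousOn_holdCost (measurableSet_singleton _)

/-- The strong Markov property as an identity of measures. -/
theorem map_shift {x : E} {T : JobPath E → ℝ≥0∞} (hT : JobPath.IsOptionalTime T)
    (hfin : ∀ᵐ ω ∂M.law x, T ω < ∞) :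
    (M.law x).map (fun ω => JobPath.shift (T ω).toNNReal ω) =
      ((M.law x).map fun ω => ω.1 (T ω).toNNReal).bind M.law := by
  have hm : Measurable fun ω : JobPath E => (T ω).toNNReal := hT.measurable.ennreal_toNNReal
  ext B hB
  have hfin' : {ω | T ω < ∞} =ᵐ[M.law x] univ := by
    filter_upwards [hfin] with ω hω
    exact eq_true hω
  rw [Measure.map_apply (JobPath.measurable_shift hm) hB,
    Measure.bind_apply hB M.law.measurable.aemeasurable,
    lintegral_map (M.law.measurable_coe hB) (JobPath.measurable_eval hm),
    ← setLIntegral_univ, ← setLIntegral_congr hfin', ← M.strongMarkov x T hT B hB]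
  refine measure_congr ?_
  filter_upwards [hfin] with ω hω
  exact propext ⟨fun h => ⟨hω, h⟩, fun h => h.2⟩

/-- No visit to `Z ∪ {done}` can precede the entry to `Y ∪ {done}`, so the clock for `Z` may be
restarted there. This is pathwise and does not need the infimum to be attained. -/
theorem entry_add {Y Z : Set E} (h : Z ⊆ Y) {ω : JobPath E} (hω : M.entry Y ω < ∞) :
    M.entry Z ω = M.entry Y ω + M.entry Z (JobPath.shift (M.entry Y ω).toNNReal ω) := by
  refine le_antisymm ?_ (le_iInf₂ fun t ht => ?_)
  · simp only [entry.eq_1 M Z (JobPath.shift _ _), ENNReal.add_iInf]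
    refine le_iInf₂ fun s hs => (iInf₂_le ((M.entry Y ω).toNNReal + s) hs).trans ?_
    rw [ENNReal.coe_add, ENNReal.coe_toNNReal hω.ne]
  · have h1 : M.entry Y ω ≤ t := iInf₂_le t (insert_subset_insert h ht)
    have h2 : (M.entry Y ω).toNNReal ≤ t := by
      rwa [← ENNReal.coe_le_coe, ENNReal.coe_toNNReal hω.ne]
    have h3 : M.entry Z (JobPath.shift (M.entry Y ω).toNNReal ω) ≤
        ((t - (M.entry Y ω).toNNReal : ℝ≥0) : ℝ≥0∞) := by
      refine iInf₂_le _ ?_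
      change ω.1 _ ∈ _
      rwa [add_tsub_cancel_of_le h2]
    calc _ ≤ M.entry Y ω + ((t - (M.entry Y ω).toNNReal : ℝ≥0) : ℝ≥0∞) := by gcongr
      _ = _ := by
        nth_rw 1 [← ENNReal.coe_toNNReal hω.ne]
        rw [← ENNReal.coe_add, add_tsub_cancel_of_le h2]

theorem holdAtEntry_shift {Y Z : Set E} (h : Z ⊆ Y) {ω : JobPath E} (hω : M.entry Y ω < ∞) :
    M.holdAtEntry Z ω = M.holdAtEntry Z (JobPath.shift (M.entry Y ω).toNNReal ω) := by
  unfold holdAtEntry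
  have h1 := entry_add h hω
  by_cases h2 : M.entry Z (JobPath.shift (M.entry Y ω).toNNReal ω) < ∞
  · rw [if_pos h2, if_pos (by rw [h1]; exact ENNReal.add_lt_top.2 ⟨hω, h2⟩), h1,
      ENNReal.toNNReal_add hω.ne h2.ne]
    rfl
  · rw [if_neg h2, if_neg (by rw [h1, ENNReal.add_lt_top]; exact fun h => h2 h.2)]

theorem entry_anti {Y Z : Set E} (h : Z ⊆ Y) (ω : JobPath E) : M.entry Y ω ≤ M.entry Z ω :=
  le_iInf₂ fun t ht => iInf₂_le t (insert_subset_insert h ht)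

theorem entry_eq_zero {Y : Set E} {ω : JobPath E} (h : ω.1 0 ∈ insert M.done Y) :
    M.entry Y ω = 0 :=
  le_antisymm (iInf₂_le (0 : ℝ≥0) h) bot_le

namespace IsGiveUpSet

variable {Y Z : Set E}

theorem aemeasurable_entry (hY : M.IsGiveUpSet Y) (μ : Measure E) [IsProbabilityMeasure μ] :
    AEMeasurable (M.entry Y) (μ.bind M.law) :=
  let ⟨T, hT, h⟩ := hY.isStopping μ inferInstance
  ⟨T, hT.measurable, h⟩

theorem aemeasurable_holdAtEntry (hY : M.IsGiveUpSet Y) (μ : Measure E)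
    [IsProbabilityMeasure μ] : AEMeasurable (M.holdAtEntry Y) (μ.bind M.law) := by
  obtain ⟨T, hT, h⟩ := hY.isStopping μ inferInstance
  refine ⟨fun ω => if T ω < ∞ then (M.holdCost (ω.1 (T ω).toNNReal) : ℝ≥0∞) else 0, ?_, ?_⟩
  · refine Measurable.ite (hT.measurable measurableSet_Iio) ?_ measurable_const
    exact (measurable_holdCost.comp
      (JobPath.measurable_eval hT.measurable.ennreal_toNNReal)).coe_nnreal_ennreal
  · filter_upwards [h] with ω hω
    rw [holdAtEntry, hω]

theorem exists_optional (hY : M.IsGiveUpSet Y) (x : E) :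
    ∃ T : JobPath E → ℝ≥0∞, JobPath.IsOptionalTime T ∧ M.entry Y =ᵐ[M.law x] T := by
  simpa [Measure.dirac_bind M.law.measurable] using hY.isStopping (Measure.dirac x) inferInstance

theorem aemeasurable_entry_law (hY : M.IsGiveUpSet Y) (x : E) :
    AEMeasurable (M.entry Y) (M.law x) :=
  let ⟨T, hT, h⟩ := hY.exists_optional x
  ⟨T, hT.measurable, h⟩

theorem aemeasurable_holdAtEntry_law (hY : M.IsGiveUpSet Y) (x : E) :
    AEMeasurable (M.holdAtEntry Y) (M.law x) := by
  simpa [Measure.dirac_bind M.law.measurable] using hY.aemeasurable_holdAtEntry (Measure.dirac x)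

theorem attained_law (hY : M.IsGiveUpSet Y) (x : E) :
    ∀ᵐ ω ∂M.law x, M.entry Y ω < ∞ → ω.1 (M.entry Y ω).toNNReal ∈ insert M.done Y := by
  simpa [Measure.dirac_bind M.law.measurable] using hY.attained (Measure.dirac x) inferInstance

theorem aemeasurable_serve (hY : M.IsGiveUpSet Y) (μ : Measure E) [IsProbabilityMeasure μ] :
    AEMeasurable (fun x => M.serve x Y) μ := by
  obtain ⟨T, hT, h⟩ := hY.isStopping μ inferInstance
  refine ⟨fun x => ∫⁻ ω, T ω ∂M.law x, hT.measurable.lintegral_kernel, ?_⟩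
  filter_upwards [Measure.ae_ae_of_ae_bind M.law.measurable.aemeasurable h] with x hx
  exact lintegral_congr_ae hx

theorem gameCost_eq (hY : M.IsGiveUpSet Y) (x : E) (r : ℝ≥0) :
    M.gameCost x r Y = ∫⁻ ω, M.entry Y ω + r * M.holdAtEntry Y ω ∂M.law x := by
  rw [lintegral_add_left' (hY.aemeasurable_entry_law x),
    lintegral_const_mul' _ _ ENNReal.coe_ne_top]
  rfl

/-- Dynamic programming: split the cost at the entry to `Y` and apply the strong Markov property to
an optional time that is almost surely this entry time. -/
theorem gameCost_eq_add (hY : M.IsGiveUpSet Y) (hZ : M.IsGiveUpSet Z) (h : Z ⊆ Y) (x : E)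
    (hfin : ∀ᵐ ω ∂M.law x, M.entry Y ω < ∞) (r : ℝ≥0) :
    M.gameCost x r Z = M.serve x Y +
      ∫⁻ ω, M.gameCost (ω.1 (M.entry Y ω).toNNReal) r Z ∂M.law x := by
  obtain ⟨T, hT, hYT⟩ := hY.exists_optional x
  have hTfin : ∀ᵐ ω ∂M.law x, T ω < ∞ := by
    filter_upwards [hYT, hfin] with ω h1 h2
    rwa [← h1]
  have hm : Measurable fun ω : JobPath E => (T ω).toNNReal := hT.measurable.ennreal_toNNReal
  -- The restarted job has the random initial state `μ`, so measurability for `Z` is needed under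
  -- `μ.bind M.law` and not only from fixed states.
  set μ : Measure E := (M.law x).map fun ω => ω.1 (T ω).toNNReal with hμ
  have : IsProbabilityMeasure μ :=
    Measure.isProbabilityMeasure_map (JobPath.measurable_eval hm).aemeasurable
  have hc : AEMeasurable (fun ω => M.entry Z ω + r * M.holdAtEntry Z ω) (μ.bind M.law) :=
    (hZ.aemeasurable_entry μ).add ((hZ.aemeasurable_holdAtEntry μ).const_mul _)
  have hg : AEMeasurable (fun y => M.gameCost y r Z) μ := by
    obtain ⟨c, hc1, hc2⟩ := hc
    refine ⟨fun y => ∫⁻ ω, c ω ∂M.law y, hc1.lintegral_kernel, ?_⟩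
    filter_upwards [Measure.ae_ae_of_ae_bind M.law.measurable.aemeasurable hc2] with y hy
    rw [hZ.gameCost_eq]
    exact lintegral_congr_ae hy
  have h1 : ∫⁻ ω, M.gameCost (ω.1 (M.entry Y ω).toNNReal) r Z ∂M.law x =
      ∫⁻ ω, M.entry Z (JobPath.shift (T ω).toNNReal ω) +
        r * M.holdAtEntry Z (JobPath.shift (T ω).toNNReal ω) ∂M.law x := by
    calc _ = ∫⁻ ω, M.gameCost (ω.1 (T ω).toNNReal) r Z ∂M.law x := by
          refine lintegral_congr_ae ?_
          filter_upwards [hYT] with ω hω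
          rw [hω]
      _ = ∫⁻ y, M.gameCost y r Z ∂μ :=
          (lintegral_map' hg (JobPath.measurable_eval hm).aemeasurable).symm
      _ = ∫⁻ ω, M.entry Z ω + r * M.holdAtEntry Z ω ∂(μ.bind M.law) := by
          rw [Measure.lintegral_bind M.law.measurable.aemeasurable hc]
          exact lintegral_congr fun y => hZ.gameCost_eq y r
      _ = _ := by
          rw [← map_shift hT hTfin] at hc ⊢
          exact lintegral_map' hc (JobPath.measurable_shift hm).aemeasurable
  rw [h1, hZ.gameCost_eq, serve, ← lintegral_add_left' (hY.aemeasurable_entry_law x)]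
  refine lintegral_congr_ae ?_
  filter_upwards [hYT, hfin] with ω h2 h3
  rw [entry_add h h3, holdAtEntry_shift h h3, h2, add_assoc]

end IsGiveUpSet

theorem gameCost_eq_of_mem {Y : Set E} {x : E} (hx : x ∈ insert M.done Y) (r : ℝ≥0) :
    M.gameCost x r Y = r * M.holdCost x := by
  have h1 : M.serve x Y = 0 := by
    rw [serve, ← lintegral_zero (μ := M.law x)]
    refine lintegral_congr_ae ?_
    filter_upwards [M.start_eq x] with ω hω
    exact entry_eq_zero (hω ▸ hx)
  have h2 : M.hold x Y = M.holdCost x := by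
    have : M.hold x Y = ∫⁻ _, (M.holdCost x : ℝ≥0∞) ∂M.law x := by
      refine lintegral_congr_ae ?_
      filter_upwards [M.start_eq x] with ω hω
      simp [holdAtEntry, entry_eq_zero (hω.symm ▸ hx), hω]
    simpa using this
  rw [gameCost, h1, h2, zero_add]

theorem game_le {Y : Set E} (hY : M.IsGiveUpSet Y) (x : E) (r : ℝ≥0) :
    M.game x r ≤ M.gameCost x r Y :=
  iInf₂_le Y hY

end JobModel

/-! ### First visit of a right-continuous path to a point -/

namespace JobPath

variable {E : Type*} [TopologicalSpace E]

/-- The first time after `T` at which the path is in `G`, among the rational times. -/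
noncomputable def hitAfter (T : JobPath E → ℝ≥0∞) (G : Set E) (ω : JobPath E) : ℝ≥0∞ :=
  ⨅ (q : ℚ) (_ : T ω < ((q : ℝ).toNNReal : ℝ≥0∞) ∧ ω.1 (q : ℝ).toNNReal ∈ G),
    ((q : ℝ).toNNReal : ℝ≥0∞)

theorem le_hitAfter (T : JobPath E → ℝ≥0∞) (G : Set E) (ω : JobPath E) :
    T ω ≤ hitAfter T G ω :=
  le_iInf₂ fun _ h => h.1.le

/-- By right continuity the path stays in the open set `G` for a while after `s`, so rational times
arbitrarily close to `s` qualify. -/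
theorem hitAfter_le {T : JobPath E → ℝ≥0∞} {G : Set E} (hG : IsOpen G) {ω : JobPath E}
    {s : ℝ≥0} (hs : T ω ≤ s) (h : ω.1 s ∈ G) : hitAfter T G ω ≤ s := by
  have h1 : ∀ᶠ u in 𝓝[≥] s, ω.1 u ∈ G := (ω.2 s).eventually (hG.mem_nhds h)
  obtain ⟨u, hu, h2⟩ := (mem_nhdsGE_iff_exists_Ico_subset).1 h1
  refine le_of_forall_gt fun b hb => ?_
  obtain ⟨q, -, h3, h4⟩ := ENNReal.lt_iff_exists_rat_btwn.1
    (lt_min hb (ENNReal.coe_lt_coe.2 hu))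
  rw [lt_min_iff] at h4
  exact (iInf₂_le q ⟨hs.trans_lt h3,
    h2 ⟨(ENNReal.coe_lt_coe.1 h3).le, ENNReal.coe_lt_coe.1 h4.2⟩⟩).trans_lt h4.1

theorem lt_hitAfter {T : JobPath E → ℝ≥0∞} {G : Set E} {ω : JobPath E} (hT : T ω < ∞)
    (h : ω.1 (T ω).toNNReal ∉ closure G) : T ω < hitAfter T G ω := by
  have h1 : ∀ᶠ u in 𝓝[≥] (T ω).toNNReal, ω.1 u ∈ (closure G)ᶜ :=
    (ω.2 _).eventually (isClosed_closure.isOpen_compl.mem_nhds h)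
  obtain ⟨u, hu, h2⟩ := (mem_nhdsGE_iff_exists_Ico_subset).1 h1
  have h3 : T ω < u := by
    rwa [← ENNReal.coe_toNNReal hT.ne, ENNReal.coe_lt_coe]
  refine h3.trans_le (le_iInf₂ fun q hq => ?_)
  by_contra! h4
  refine h2 ⟨?_, ENNReal.coe_lt_coe.1 h4⟩ (subset_closure hq.2)
  rw [← ENNReal.coe_le_coe, ENNReal.coe_toNNReal hT.ne]
  exact hq.1.le

variable [MeasurableSpace E]

theorem measurableSet_past_coord [BorelSpace E] {s t : ℝ≥0} (h : s ≤ t) {A : Set E}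
    (hA : MeasurableSet A) : MeasurableSet[past t] {ω : JobPath E | ω.1 s ∈ A} :=
  le_iSup₂ (f := fun (s : ℝ≥0) (_ : s ≤ t) =>
    MeasurableSpace.comap (fun ω : JobPath E => ω.1 s) inferInstance) s h _ ⟨A, hA, rfl⟩

theorem past_mono {s t : ℝ≥0} (h : s ≤ t) : (past s : MeasurableSpace (JobPath E)) ≤ past t :=
  iSup₂_le fun u hu => le_iSup₂ (f := fun (s : ℝ≥0) (_ : s ≤ t) =>
    MeasurableSpace.comap (fun ω : JobPath E => ω.1 s) inferInstance) u (hu.trans h)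

theorem IsOptionalTime.iSup {T : ℕ → JobPath E → ℝ≥0∞} (hT : ∀ n, IsOptionalTime (T n)) :
    IsOptionalTime fun ω => ⨆ n, T n ω := by
  intro t
  have h : {ω | ⨆ n, T n ω < t} = ⋃ q : ℚ, ⋃ _ : (q : ℝ).toNNReal < t,
      ⋂ n, {ω | T n ω < ((q : ℝ).toNNReal : ℝ≥0∞)} := by
    ext ω
    simp only [mem_iUnion, mem_iInter, mem_ofPred_eq, exists_prop]
    refine ⟨fun h => ?_, fun ⟨q, hq, h⟩ => ?_⟩
    · obtain ⟨q, -, h1, h2⟩ := ENNReal.lt_iff_exists_rat_btwn.1 h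
      exact ⟨q, ENNReal.coe_lt_coe.1 h2, fun n => (le_iSup _ n).trans_lt h1⟩
    · exact (iSup_le fun n => (h n).le).trans_lt (ENNReal.coe_lt_coe.2 hq)
  rw [h]
  exact MeasurableSet.iUnion fun q => MeasurableSet.iUnion fun hq =>
    MeasurableSet.iInter fun n => past_mono hq.le _ (hT n _)

theorem IsOptionalTime.hitAfter [BorelSpace E] {T : JobPath E → ℝ≥0∞} (hT : IsOptionalTime T)
    {G : Set E} (hG : MeasurableSet G) : IsOptionalTime (JobPath.hitAfter T G) := by
  intro t
  have h : {ω | JobPath.hitAfter T G ω < t} = ⋃ q : ℚ, ⋃ _ : (q : ℝ).toNNReal < t,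
      {ω | T ω < ((q : ℝ).toNNReal : ℝ≥0∞)} ∩ {ω | ω.1 (q : ℝ).toNNReal ∈ G} := by
    ext ω
    simp only [JobPath.hitAfter, iInf_lt_iff, mem_iUnion, mem_inter_iff, mem_ofPred_eq,
      exists_prop, ENNReal.coe_lt_coe]
    exact exists_congr fun q => and_comm
  rw [h]
  exact MeasurableSet.iUnion fun q => MeasurableSet.iUnion fun hq =>
    (past_mono hq.le _ (hT _)).inter (measurableSet_past_coord hq.le hG)

/-- The first time at which a right-continuous path is in a given point `c` is almost surely equal
to an optional time, and the path is in `c` at this time. -/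
theorem exists_isOptionalTime_debut [TopologicalSpace.MetrizableSpace E] [BorelSpace E] (c : E)
    (μ : Measure (JobPath E)) [IsFiniteMeasure μ] :
    ∃ T : JobPath E → ℝ≥0∞, IsOptionalTime T ∧ (∀ ω (s : ℝ≥0), ω.1 s = c → T ω ≤ s) ∧
      ∀ᵐ ω ∂μ, T ω < ∞ → ω.1 (T ω).toNNReal = c := by
  let _ := TopologicalSpace.metrizableSpaceMetric E
  let G : ℕ → Set E := fun n => Metric.ball c (1 / (n + 1))
  have hGo (n : ℕ) : IsOpen (G n) := Metric.isOpen_ball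
  have hcG (n : ℕ) : c ∈ G n := Metric.mem_ball_self (by positivity)
  have hG (x : E) (hx : x ≠ c) : ∃ n, x ∉ closure (G n) := by
    obtain ⟨n, hn⟩ := exists_nat_one_div_lt (dist_pos.2 hx)
    exact ⟨n, fun h => hn.not_ge (Metric.closure_ball_subset_closedBall h)⟩
  -- `𝒯` consists of the optional lower bounds of the first visit to `c`. The functional `J` is
  -- finite and decreases in `T`, so the supremum of a minimizing sequence is an essentially largest
  -- element of `𝒯`.
  let 𝒯 : Set (JobPath E → ℝ≥0∞) := {T | IsOptionalTime T ∧ ∀ ω (s : ℝ≥0), ω.1 s = c → T ω ≤ s}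
  let J : (JobPath E → ℝ≥0∞) → ℝ≥0∞ := fun T => ∫⁻ ω, (1 + T ω)⁻¹ ∂μ
  have h0 : (fun _ => 0) ∈ 𝒯 := ⟨fun t => by
    by_cases ht : (0 : ℝ≥0∞) < t <;> simp [ht], fun _ _ _ => zero_le⟩
  obtain ⟨u, -, hu, hu'⟩ := exists_seq_tendsto_sInf (S := J '' 𝒯) ⟨_, mem_image_of_mem J h0⟩
    (OrderBot.bddBelow _)
  choose T hT hTu using hu'
  let S : JobPath E → ℝ≥0∞ := fun ω => ⨆ n, T n ω
  have hS : S ∈ 𝒯 := ⟨IsOptionalTime.iSup fun n => (hT n).1,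
    fun ω s h => iSup_le fun n => (hT n).2 ω s h⟩
  -- `S'` waits after `S` for every ball around `c`. It is still in `𝒯`, so minimality of `J S`
  -- forces `S' = S` almost surely; but where the path at `S` is not in `c`, some ball has not been
  -- reached and `S < S'`.
  let S' : JobPath E → ℝ≥0∞ := fun ω => ⨆ n, hitAfter S (G n) ω
  have hS' : S' ∈ 𝒯 := ⟨IsOptionalTime.iSup fun n => hS.1.hitAfter (hGo n).measurableSet,
    fun ω s h => iSup_le fun n => hitAfter_le (hGo n) (hS.2 ω s h) (h ▸ hcG n)⟩
  have hSS' (ω : JobPath E) : S ω ≤ S' ω := 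
    (le_hitAfter S (G 0) ω).trans (le_iSup (fun n => hitAfter S (G n) ω) 0)
  have hJS : J S ≤ J S' := by
    refine le_trans ?_ (sInf_le (mem_image_of_mem J hS'))
    refine ge_of_tendsto' hu fun n => ?_
    rw [← hTu n]
    refine lintegral_mono fun ω => ?_
    have : T n ω ≤ S ω := le_iSup (fun n => T n ω) n
    gcongr
  have hfin : J S' ≠ ∞ := by
    refine ((lintegral_mono fun ω => ?_).trans_lt
      (by simp : ∫⁻ _, (1 : ℝ≥0∞) ∂μ < ∞)).ne
    simp
  have hae : (fun ω => (1 + S' ω)⁻¹) =ᵐ[μ] fun ω => (1 + S ω)⁻¹ := by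
    refine ae_eq_of_ae_le_of_lintegral_le (ae_of_all _ fun ω => ?_) hfin
      ((hS.1.measurable.const_add 1).inv.aemeasurable) hJS
    have := hSS' ω
    dsimp only
    gcongr
  refine ⟨S, hS.1, hS.2, ?_⟩
  filter_upwards [hae] with ω hω hfinω
  by_contra hne
  obtain ⟨n, hn⟩ := hG _ hne
  have h1 : S ω < S' ω := (lt_hitAfter hfinω hn).trans_le (le_iSup (fun n => hitAfter S (G n) ω) n)
  rw [inv_inj, ENNReal.add_right_inj ENNReal.one_ne_top] at hω
  exact h1.ne hω.symm

end JobPath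

/-! ### Optimality and monotonicity of the sets `optSet r` -/

namespace JobModel

variable {E : Type*} [TopologicalSpace E] [TopologicalSpace.MetrizableSpace E]
  [MeasurableSpace E] [BorelSpace E] {M : JobModel E}

theorem isGiveUpSet_empty : M.IsGiveUpSet ∅ := by
  have key (μ : Measure E) (_ : IsProbabilityMeasure μ) : ∃ T : JobPath E → ℝ≥0∞,
      JobPath.IsOptionalTime T ∧ ∀ᵐ ω ∂(μ.bind M.law), M.entry ∅ ω = T ω ∧
        (T ω < ∞ → ω.1 (T ω).toNNReal = M.done) := by
    obtain ⟨T, hT, hle, hae⟩ := JobPath.exists_isOptionalTime_debut M.done (μ.bind M.law)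
    refine ⟨T, hT, ?_⟩
    filter_upwards [hae] with ω hω
    refine ⟨le_antisymm ?_ (le_iInf₂ fun s hs => hle ω s (by simpa using hs)), hω⟩
    rcases eq_top_or_lt_top (T ω) with h | h
    · exact h ▸ le_top
    · refine (iInf₂_le (T ω).toNNReal (by simpa using hω h)).trans ?_
      rw [ENNReal.coe_toNNReal h.ne]
  refine ⟨empty_subset _, fun μ hμ => ?_, fun μ hμ => ?_⟩
  · obtain ⟨T, hT, h⟩ := key μ hμ
    exact ⟨T, hT, h.mono fun ω hω => hω.1⟩
  · obtain ⟨T, hT, h⟩ := key μ hμ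
    filter_upwards [h] with ω hω
    rw [hω.1]
    intro h1
    simpa using hω.2 h1

/-- Never giving up is a strategy, and it ends in `done`, where the holding cost is zero. -/
theorem game_le_serve (x : E) (r : ℝ≥0) : M.game x r ≤ M.serve x ∅ := by
  refine (game_le isGiveUpSet_empty x r).trans (le_of_eq ?_)
  have h : M.hold x ∅ = 0 := by
    rw [hold, ← lintegral_zero (μ := M.law x)]
    refine lintegral_congr_ae ?_
    filter_upwards [isGiveUpSet_empty.attained_law x] with ω hω
    unfold holdAtEntry
    split_ifs with h
    · have : ω.1 (M.entry ∅ ω).toNNReal = M.done := by simpa using hω h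
      simp [this, M.holdCost_done]
    · rfl
  rw [gameCost, h, mul_zero, add_zero]

theorem ae_entry_lt_top {x : E} (hx : M.serve x ∅ < ∞) (Y : Set E) :
    ∀ᵐ ω ∂M.law x, M.entry Y ω < ∞ := by
  filter_upwards [ae_lt_top' (isGiveUpSet_empty.aemeasurable_entry_law x) hx.ne] with ω hω
  exact (entry_anti (empty_subset Y) ω).trans_lt hω

theorem serve_anti {Y Z : Set E} (h : Z ⊆ Y) (x : E) : M.serve x Y ≤ M.serve x Z :=
  lintegral_mono fun ω => entry_anti h ω

theorem game_le_holdCost (hM : M.GameSolvable) {x : E} (hx : x ∈ M.preemptible) (r : ℝ≥0) :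
    M.game x r ≤ r * M.holdCost x :=
  (game_le hM.isGiveUpSet_preemptible x r).trans_eq (gameCost_eq_of_mem (mem_insert_of_mem _ hx) r)

/-- Giving up as soon as giving up immediately is optimal is an optimal strategy. -/
theorem gameCost_optSet (hM : M.GameSolvable) {x : E} (hx : x ∈ M.preemptible)
    (hfin : M.serve x ∅ < ∞) (r : ℝ≥0) : M.gameCost x r (M.optSet r) = M.game x r := by
  obtain ⟨Z, hZ, hopt⟩ := hM.exists_optimal r
  have hY := hM.isGiveUpSet_optSet r
  -- In a state of `Z` the optimal strategy `Z` stops at once, so stopping there is optimal.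
  have hsub : Z ⊆ M.optSet r := fun y hy => by
    have hy' := hZ.subset hy
    exact ⟨hy', by rw [← hopt y hy', gameCost_eq_of_mem (mem_insert_of_mem _ hy)]⟩
  have hf := ae_entry_lt_top hfin (M.optSet r)
  rw [← hopt x hx, hY.gameCost_eq_add hZ hsub x hf r, gameCost, hold,
    ← lintegral_const_mul' _ _ ENNReal.coe_ne_top]
  congr 1
  refine lintegral_congr_ae ?_
  filter_upwards [hf, hY.attained_law x] with ω h1 h2
  rw [holdAtEntry, if_pos h1]
  -- On entry to `optSet r ∪ {done}`, continuing with `Z` costs exactly as much as stopping: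
  -- trivially in `done`, and by optimality of `Z` elsewhere.
  rcases h2 h1 with h3 | h3
  · rw [gameCost_eq_of_mem (h3 ▸ mem_insert _ _)]
  · rw [hopt _ h3.1, h3.2]

/-- Scale the optimality inequality at `r` by `s / r ≤ 1`: the holding terms become those for `s`,
and the service term only shrinks. -/
theorem optSet_anti (hM : M.GameSolvable) {r s : ℝ≥0} (h : s ≤ r) :
    M.optSet r ⊆ M.optSet s := by
  intro x hx
  refine ⟨hx.1, le_antisymm (game_le_holdCost hM hx.1 s) (le_iInf₂ fun Y hY => ?_)⟩
  rcases eq_or_ne r 0 with rfl | hr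
  · simp [nonpos_iff_eq_zero.1 h]
  have h1 : (r : ℝ≥0∞) * M.holdCost x ≤ M.gameCost x r Y := hx.2 ▸ game_le hY x r
  have h2 : ((s / r : ℝ≥0) : ℝ≥0∞) * r = s := by
    rw [← ENNReal.coe_mul, div_mul_cancel₀ _ hr]
  calc (s : ℝ≥0∞) * M.holdCost x = ((s / r : ℝ≥0) : ℝ≥0∞) * (r * M.holdCost x) := by
        rw [← mul_assoc, h2]
    _ ≤ ((s / r : ℝ≥0) : ℝ≥0∞) * (M.serve x Y + r * M.hold x Y) := by gcongr; exact h1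
    _ = ((s / r : ℝ≥0) : ℝ≥0∞) * M.serve x Y + s * M.hold x Y := by
        rw [mul_add, ← mul_assoc, h2]
    _ ≤ 1 * M.serve x Y + s * M.hold x Y := by
        gcongr
        exact_mod_cast div_le_one_of_le₀ h zero_le
    _ = _ := by rw [one_mul]; rfl

end JobModel

/-- A function with the supporting lines `u ↦ s r + u * h r` has derivative `h` wherever it is
differentiable, and `-s r / r ^ 2` is the derivative of `f r / r`, whence the integral of
`s r / r ^ 2` is the total decrease of `f r / r`. -/
theorem lintegral_Ioi_div_sq_of_support {f s h : ℝ → ℝ} {S c : ℝ}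
    (heq : ∀ r, 0 < r → f r = s r + r * h r)
    (hle : ∀ r u, 0 < r → 0 < u → f u ≤ s r + u * h r)
    (hs0 : ∀ r, 0 < r → 0 ≤ s r) (hsS : ∀ r, 0 < r → s r ≤ S)
    (hderiv : ∀ᵐ r ∂(volume.restrict (Ioi (0 : ℝ))), HasDerivAt f (h r) r)
    (hzero : Tendsto (fun n : ℕ => f (1 / ((n : ℝ) + 1)) / (1 / ((n : ℝ) + 1))) atTop (𝓝 c))
    (htop : Tendsto (fun n : ℕ => f ((n : ℝ) + 1) / ((n : ℝ) + 1)) atTop (𝓝 0)) :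
    ∫⁻ r in Ioi (0 : ℝ), ENNReal.ofReal (s r / r ^ 2) = ENNReal.ofReal c := by
  have hS : 0 ≤ S := (hs0 1 one_pos).trans (hsS 1 one_pos)
  set g : ℝ → ℝ := fun r => f r / r with hg
  have hgeq (r : ℝ) (hr : 0 < r) : g r = s r / r + h r := by
    simp only [hg]; rw [heq r hr]; field_simp
  have hgle (r u : ℝ) (hr : 0 < r) (hu : 0 < u) : g u ≤ s r / u + h r := by
    have := div_le_div_of_nonneg_right (hle r u hr hu) hu.le
    simp only [hg]
    refine this.trans_eq ?_
    field_simp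
  have hgd : ∀ᵐ r ∂(volume.restrict (Ioi (0 : ℝ))), HasDerivAt g (-(s r / r ^ 2)) r := by
    filter_upwards [hderiv, ae_restrict_mem measurableSet_Ioi] with r hr (hr0 : 0 < r)
    refine (hr.div (hasDerivAt_id r) hr0.ne').congr_deriv ?_
    simp only [id]
    rw [heq r hr0]
    field_simp
    ring
  have hlip {a b : ℝ} (ha : 0 < a) : LipschitzOnWith (S / a ^ 2).toNNReal g (Icc a b) := by
    -- The supporting line at `r` gives `g u ≤ g r`, and the one at `u` gives `g r - g u ≤ s u * (1
    -- / r - 1 / u)`. The resulting Lipschitz bound makes `g` absolutely continuous, so almost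
    -- everywhere knowledge of the derivative suffices.
    have key {r u : ℝ} (hr : a ≤ r) (hru : r ≤ u) : |g r - g u| ≤ S / a ^ 2 * (u - r) := by
      have hr0 := ha.trans_le hr
      have hu0 := hr0.trans_le hru
      have h1 : g u ≤ g r := by
        refine (hgle r u hr0 hu0).trans ?_
        rw [hgeq r hr0]
        gcongr
        exact hs0 r hr0
      rw [abs_of_nonneg (sub_nonneg.2 h1)]
      have h2 : g r - g u ≤ s u / r - s u / u := by
        linarith [hgle u r hu0 hr0, hgeq u hu0]
      calc _ ≤ s u / r - s u / u := h2
        _ = s u / (r * u) * (u - r) := by field_simp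
        _ ≤ S / a ^ 2 * (u - r) := by
          refine mul_le_mul_of_nonneg_right ?_ (sub_nonneg.2 hru)
          rw [sq]
          have := hsS u hu0
          have := hr.trans hru
          gcongr
    refine LipschitzOnWith.of_dist_le_mul fun r hr u hu => ?_
    rw [Real.coe_toNNReal _ (by positivity), Real.dist_eq, Real.dist_eq]
    rcases le_total r u with h | h
    · rw [abs_sub_comm r u, abs_of_nonneg (sub_nonneg.2 h)]
      exact key hr.1 h
    · rw [abs_sub_comm (g r), abs_of_nonneg (sub_nonneg.2 h)]
      exact key hu.1 h
  have hint {a b : ℝ} (ha : 0 < a) (hab : a ≤ b) :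
      ∫⁻ r in Ioc a b, ENNReal.ofReal (s r / r ^ 2) = ENNReal.ofReal (g a - g b) := by
    have hac : AbsolutelyContinuousOnInterval g a b :=
      LipschitzOnWith.absolutelyContinuousOnInterval (by rw [uIcc_of_le hab]; exact hlip ha)
    have hd : ∀ᵐ r ∂(volume.restrict (Ioc a b)), -deriv g r = s r / r ^ 2 := by
      filter_upwards [ae_restrict_of_ae_restrict_of_subset
        (fun r hr => ha.trans hr.1 : Ioc a b ⊆ Ioi 0) hgd] with r hr
      rw [hr.deriv, neg_neg]
    have hi : IntegrableOn (fun r => -deriv g r) (Ioc a b) :=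
      ((intervalIntegrable_iff_integrableOn_Ioc_of_le hab).1 hac.intervalIntegrable_deriv).neg
    rw [← neg_sub, ← hac.integral_deriv_eq_sub, intervalIntegral.integral_of_le hab,
      ← integral_neg, ofReal_integral_eq_lintegral_ofReal hi]
    · refine lintegral_congr_ae ?_
      filter_upwards [hd] with r hr
      rw [hr]
    · filter_upwards [hd, ae_restrict_mem measurableSet_Ioc] with r hr hr'
      rw [hr]
      have := hs0 r (ha.trans hr'.1)
      exact div_nonneg this (sq_nonneg _)
  let I : ℕ → Set ℝ := fun n => Ioc (1 / ((n : ℝ) + 1)) ((n : ℝ) + 1)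
  have hImono : Monotone I := fun m n hmn => Ioc_subset_Ioc (by gcongr) (by gcongr)
  have hI : Ioi (0 : ℝ) = ⋃ n, I n := by
    ext r
    simp only [mem_Ioi, mem_iUnion, I, mem_Ioc]
    refine ⟨fun hr => ?_, fun ⟨n, hn, _⟩ => lt_trans (by positivity) hn⟩
    obtain ⟨m, hm⟩ := exists_nat_one_div_lt hr
    obtain ⟨k, hk⟩ := exists_nat_ge r
    refine ⟨max m k, lt_of_le_of_lt ?_ hm, ?_⟩
    · gcongr
      exact le_max_left _ _
    · have : (k : ℝ) ≤ (max m k : ℕ) := by exact_mod_cast le_max_right _ _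
      linarith
  rw [hI, setLIntegral_iUnion_of_directed _ (directed_of_isDirected_le hImono)]
  refine tendsto_nhds_unique (tendsto_atTop_iSup fun m n hmn => lintegral_mono_set (hImono hmn)) ?_
  have hlim : Tendsto (fun n : ℕ => g (1 / ((n : ℝ) + 1)) - g ((n : ℝ) + 1)) atTop (𝓝 (c - 0)) :=
    hzero.sub htop
  rw [sub_zero] at hlim
  refine (ENNReal.tendsto_ofReal hlim).congr fun n => ?_
  refine (hint (by positivity) ?_).symm
  rw [div_le_iff₀ (by positivity)]
  nlinarith [(Nat.cast_nonneg n : (0 : ℝ) ≤ n)]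

/-! ### Concavity, derivative and integral formula for the game -/

namespace JobModel

variable {E : Type*} [TopologicalSpace E] [TopologicalSpace.MetrizableSpace E]
  [MeasurableSpace E] [BorelSpace E] {M : JobModel E}

theorem game_mono (x : E) {r s : ℝ≥0} (h : r ≤ s) : M.game x r ≤ M.game x s := by
  refine le_iInf₂ fun Y hY => (game_le hY x r).trans ?_
  unfold gameCost
  gcongr

theorem game_combo_le (x : E) {a b : ℝ≥0} (hab : a + b = 1) (r s : ℝ≥0) :
    a * M.game x r + b * M.game x s ≤ M.game x (a * r + b * s) := by
  refine le_iInf₂ fun Y hY => ?_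
  calc a * M.game x r + b * M.game x s ≤ a * M.gameCost x r Y + b * M.gameCost x s Y := by
        gcongr <;> exact game_le hY x _
    _ = ((a + b : ℝ≥0) : ℝ≥0∞) * M.serve x Y + (a * r + b * s) * M.hold x Y := by
        simp only [gameCost, ENNReal.coe_add]
        ring
    _ = _ := by
        rw [hab, ENNReal.coe_one, one_mul]
        simp [gameCost]

theorem game_ne_top {x : E} (hfin : M.serve x ∅ < ∞) (r : ℝ≥0) : M.game x r ≠ ∞ :=
  ((game_le_serve x r).trans_lt hfin).ne

theorem serve_ne_top {x : E} (hfin : M.serve x ∅ < ∞) (Y : Set E) : M.serve x Y ≠ ∞ :=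
  ((serve_anti (empty_subset Y) x).trans_lt hfin).ne

theorem concaveOn_game {x : E} (hfin : M.serve x ∅ < ∞) :
    ConcaveOn ℝ (Ici 0) fun r : ℝ => (M.game x r.toNNReal).toReal := by
  refine ⟨convex_Ici 0, fun r hr s hs a b ha hb hab => ?_⟩
  lift r to ℝ≥0 using hr
  lift s to ℝ≥0 using hs
  lift a to ℝ≥0 using ha
  lift b to ℝ≥0 using hb
  have h := ENNReal.toReal_mono (game_ne_top hfin _)
    (game_combo_le (M := M) x (a := a) (b := b) (by exact_mod_cast hab) r s)
  rw [ENNReal.toReal_add (ENNReal.mul_ne_top ENNReal.coe_ne_top (game_ne_top hfin _))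
    (ENNReal.mul_ne_top ENNReal.coe_ne_top (game_ne_top hfin _)), ENNReal.toReal_mul,
    ENNReal.toReal_mul] at h
  simp only [smul_eq_mul, Real.toNNReal_coe]
  have h2 : ((a : ℝ) * r + b * s).toNNReal = a * r + b * s := by
    rw [← Real.toNNReal_coe (r := a * r + b * s)]
    push_cast
    rfl
  rw [h2]
  exact h

/-- With a positive penalty, an infinite mean holding cost would make the optimal cost infinite. At
`r = 0` this argument fails, since `0 * ∞ = 0`. -/
theorem hold_ne_top (hM : M.GameSolvable) {x : E} (hx : x ∈ M.preemptible)
    (hfin : M.serve x ∅ < ∞) {r : ℝ≥0} (hr : r ≠ 0) : M.hold x (M.optSet r) ≠ ∞ := by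
  intro h
  have h1 := gameCost_optSet hM hx hfin r
  rw [gameCost, h, ENNReal.mul_top (by simpa using hr), add_top] at h1
  exact game_ne_top hfin r h1.symm

theorem toReal_game_eq (hM : M.GameSolvable) {x : E} (hx : x ∈ M.preemptible)
    (hfin : M.serve x ∅ < ∞) {r : ℝ} (hr : 0 < r) :
    (M.game x r.toNNReal).toReal = (M.serve x (M.optSet r.toNNReal)).toReal +
      r * (M.hold x (M.optSet r.toNNReal)).toReal := by
  have hr' : r.toNNReal ≠ 0 := by simpa using hr
  rw [← gameCost_optSet hM hx hfin, gameCost, ENNReal.toReal_add (serve_ne_top hfin _)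
    (ENNReal.mul_ne_top ENNReal.coe_ne_top (hold_ne_top hM hx hfin hr')), ENNReal.toReal_mul,
    ENNReal.coe_toReal, Real.coe_toNNReal r hr.le]

theorem toReal_game_le (hM : M.GameSolvable) {x : E} (hx : x ∈ M.preemptible)
    (hfin : M.serve x ∅ < ∞) {r u : ℝ} (hr : 0 < r) (hu : 0 < u) :
    (M.game x u.toNNReal).toReal ≤ (M.serve x (M.optSet r.toNNReal)).toReal +
      u * (M.hold x (M.optSet r.toNNReal)).toReal := by
  have hr' : r.toNNReal ≠ 0 := by simpa using hr
  have hne := ENNReal.mul_ne_top (ENNReal.coe_ne_top (r := u.toNNReal))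
    (hold_ne_top hM hx hfin hr')
  refine (ENNReal.toReal_mono (ENNReal.add_ne_top.2 ⟨serve_ne_top hfin _, hne⟩)
    (game_le (hM.isGiveUpSet_optSet r.toNNReal) x u.toNNReal)).trans_eq ?_
  rw [ENNReal.toReal_add (serve_ne_top hfin _) hne, ENNReal.toReal_mul,
    ENNReal.coe_toReal, Real.coe_toNNReal u hu.le]

/-- A monotone function is differentiable almost everywhere. The game minus its supporting line at
`r` has a local maximum at `r`, so the two slopes agree. -/
theorem ae_hasDerivAt_game (hM : M.GameSolvable) {x : E} (hx : x ∈ M.preemptible)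
    (hfin : M.serve x ∅ < ∞) :
    ∀ᵐ r ∂(volume.restrict (Ioi (0 : ℝ))),
      HasDerivAt (fun u : ℝ => (M.game x u.toNNReal).toReal)
        (M.hold x (M.optSet r.toNNReal)).toReal r := by
  have hmono : Monotone fun u : ℝ => (M.game x u.toNNReal).toReal := fun u v huv =>
    ENNReal.toReal_mono (game_ne_top hfin _) (game_mono x (Real.toNNReal_mono huv))
  filter_upwards [ae_restrict_of_ae hmono.ae_differentiableAt,
    ae_restrict_mem measurableSet_Ioi] with r hd (hr : 0 < r)
  have h1 := hd.hasDerivAt.sub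
    ((hasDerivAt_id r).mul_const (M.hold x (M.optSet r.toNNReal)).toReal)
  have h2 : IsLocalMax ((fun u : ℝ => (M.game x u.toNNReal).toReal) - fun u : ℝ =>
      id u * (M.hold x (M.optSet r.toNNReal)).toReal) r := by
    filter_upwards [lt_mem_nhds hr] with u hu
    simp only [Pi.sub_apply, id]
    linarith [toReal_game_eq hM hx hfin hr, toReal_game_le hM hx hfin hr hu]
  have h3 := h2.hasDerivAt_eq_zero h1
  rw [one_mul, sub_eq_zero] at h3
  exact h3 ▸ hd.hasDerivAt

/-- The optimal cost is at most `a n * holdCost x`, so the mean entry times vanish; they decrease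
pathwise, hence tend to `0` almost surely. Right continuity and continuity of `holdCost` at `x ≠
done` give pathwise convergence. Fatou's lemma yields the lower bound, and the cost bound divided by
`a n` the upper one. -/
theorem tendsto_hold_optSet (hM : M.GameSolvable) {x : E} (hx : x ∈ M.preemptible)
    (hfin : M.serve x ∅ < ∞) {a : ℕ → ℝ≥0} (ha : Antitone a) (ha0 : ∀ n, a n ≠ 0)
    (hlim : Tendsto a atTop (𝓝 0)) :
    Tendsto (fun n => M.hold x (M.optSet (a n))) atTop (𝓝 (M.holdCost x)) := by
  have hent (n : ℕ) := (hM.isGiveUpSet_optSet (a n)).aemeasurable_entry_law x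
  have hle (n : ℕ) : M.serve x (M.optSet (a n)) + a n * M.hold x (M.optSet (a n)) ≤
      a n * M.holdCost x := (gameCost_optSet hM hx hfin (a n)).trans_le (game_le_holdCost hM hx _)
  have hzero : ∫⁻ ω, ⨅ n, M.entry (M.optSet (a n)) ω ∂M.law x = 0 := by
    refine le_antisymm ?_ bot_le
    have h1 : Tendsto (fun n => (a n : ℝ≥0∞) * M.holdCost x) atTop (𝓝 0) := by
      have h2 : Tendsto (fun n => ((a n * M.holdCost x : ℝ≥0) : ℝ≥0∞)) atTop
          (𝓝 ((0 * M.holdCost x : ℝ≥0) : ℝ≥0∞)) :=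
        ENNReal.tendsto_coe.2 (hlim.mul_const _)
      simpa using h2
    refine ge_of_tendsto' h1 fun n => ?_
    exact (lintegral_mono fun ω => iInf_le _ n).trans (le_self_add.trans (hle n))
  have hconv : ∀ᵐ ω ∂M.law x, Tendsto (fun n => M.holdAtEntry (M.optSet (a n)) ω) atTop
      (𝓝 (M.holdCost x)) := by
    filter_upwards [(lintegral_eq_zero_iff' (AEMeasurable.iInf hent)).1 hzero, M.start_eq x]
      with ω hω hstart
    have hT : Tendsto (fun n => M.entry (M.optSet (a n)) ω) atTop (𝓝 0) := by
      have h1 : ⨅ n, M.entry (M.optSet (a n)) ω = 0 := hω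
      rw [← h1]
      exact tendsto_atTop_iInf fun m n hmn => entry_anti (optSet_anti hM (ha hmn)) ω
    have hTr : Tendsto (fun n => (M.entry (M.optSet (a n)) ω).toNNReal) atTop (𝓝[≥] 0) := by
      refine tendsto_nhdsWithin_iff.2 ⟨?_, Eventually.of_forall fun n => mem_Ici.2 zero_le⟩
      exact (ENNReal.tendsto_toNNReal ENNReal.zero_ne_top).comp hT
    have hX := (ω.2 0).tendsto.comp hTr
    have hxd : x ≠ M.done := fun h => M.done_notMem (h ▸ hx)
    have hc : ContinuousAt M.holdCost (ω.1 0) :=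
      M.continuousOn_holdCost.continuousAt (isOpen_compl_singleton.mem_nhds (hstart ▸ hxd))
    have h2 := ENNReal.tendsto_coe.2 (hc.tendsto.comp hX)
    rw [hstart] at h2
    refine h2.congr' ?_
    filter_upwards [hT.eventually (gt_mem_nhds ENNReal.zero_lt_top)] with n hn
    rw [holdAtEntry, if_pos hn]
    rfl
  refine tendsto_of_le_liminf_of_limsup_le ?_ ?_
  · calc (M.holdCost x : ℝ≥0∞) = ∫⁻ _, (M.holdCost x : ℝ≥0∞) ∂M.law x := by simp
      _ = ∫⁻ ω, liminf (fun n => M.holdAtEntry (M.optSet (a n)) ω) atTop ∂M.law x := by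
        refine lintegral_congr_ae ?_
        filter_upwards [hconv] with ω hω
        exact hω.liminf_eq.symm
      _ ≤ _ := lintegral_liminf_le' fun n =>
        (hM.isGiveUpSet_optSet (a n)).aemeasurable_holdAtEntry_law x
  · refine limsup_le_of_le (by isBoundedDefault) (Eventually.of_forall fun n => ?_)
    have h1 := le_add_self.trans (hle n)
    rwa [ENNReal.mul_le_mul_iff_right (by simpa using ha0 n) ENNReal.coe_ne_top] at h1

theorem holdCost_eq_lintegral (hM : M.GameSolvable) {x : E} (hx : x ∈ M.preemptible)
    (hfin : M.serve x ∅ < ∞) :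
    (M.holdCost x : ℝ≥0∞) =
      ∫⁻ r in Ioi (0 : ℝ), M.serve x (M.optSet r.toNNReal) / ENNReal.ofReal (r ^ 2) := by
  have h := lintegral_Ioi_div_sq_of_support
    (f := fun u => (M.game x u.toNNReal).toReal)
    (s := fun r => (M.serve x (M.optSet r.toNNReal)).toReal)
    (h := fun r => (M.hold x (M.optSet r.toNNReal)).toReal)
    (S := (M.serve x ∅).toReal) (c := M.holdCost x)
    (fun r hr => toReal_game_eq hM hx hfin hr)
    (fun r u hr hu => toReal_game_le hM hx hfin hr hu)
    (fun r _ => ENNReal.toReal_nonneg)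
    (fun r _ => ENNReal.toReal_mono hfin.ne (serve_anti (empty_subset _) x))
    (ae_hasDerivAt_game hM hx hfin) ?_ ?_
  · rw [ENNReal.ofReal_coe_nnreal] at h
    rw [← h]
    refine setLIntegral_congr_fun measurableSet_Ioi fun r (hr : 0 < r) => ?_
    rw [ENNReal.ofReal_div_of_pos (by positivity), ENNReal.ofReal_toReal (serve_ne_top hfin _)]
  · let a : ℕ → ℝ≥0 := fun n => 1 / ((n : ℝ≥0) + 1)
    have ha (n : ℕ) : (1 / ((n : ℝ) + 1)).toNNReal = a n := by
      rw [← Real.toNNReal_coe (r := a n)]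
      simp [a]
    have h1 := tendsto_hold_optSet hM hx hfin (a := a) (fun m n hmn => by
      simp only [a]; gcongr) (fun n => by simp only [a]; positivity)
      tendsto_one_div_add_atTop_nhds_zero_nat
    -- `game x r / r` lies between `hold x (optSet r)` and `holdCost x`.
    refine tendsto_of_tendsto_of_tendsto_of_le_of_le
      ((ENNReal.tendsto_toReal ENNReal.coe_ne_top).comp h1) tendsto_const_nhds (fun n => ?_)
      fun n => ?_
    · have h2 : (0 : ℝ) < 1 / ((n : ℝ) + 1) := by positivity
      change _ ≤ _ / _
      rw [le_div_iff₀ h2, toReal_game_eq hM hx hfin h2, ha, mul_comm]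
      exact le_add_of_nonneg_left ENNReal.toReal_nonneg
    · have h2 : (0 : ℝ) < 1 / ((n : ℝ) + 1) := by positivity
      change _ / _ ≤ _
      rw [div_le_iff₀ h2]
      have h3 := ENNReal.toReal_mono (ENNReal.mul_ne_top ENNReal.coe_ne_top ENNReal.coe_ne_top)
        (game_le_holdCost hM hx (1 / ((n : ℝ) + 1)).toNNReal)
      rwa [ENNReal.toReal_mul, ENNReal.coe_toReal, ENNReal.coe_toReal, Real.coe_toNNReal _ h2.le,
        mul_comm] at h3
  · have h1 : Tendsto (fun n : ℕ => (M.serve x ∅).toReal * (1 / ((n : ℝ) + 1))) atTop (𝓝 0) := by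
      simpa using tendsto_one_div_add_atTop_nhds_zero_nat.const_mul (M.serve x ∅).toReal
    refine tendsto_of_tendsto_of_tendsto_of_le_of_le tendsto_const_nhds h1 (fun n => ?_)
      fun n => ?_
    · exact div_nonneg ENNReal.toReal_nonneg (by positivity)
    · change _ / _ ≤ _
      rw [div_eq_mul_one_div]
      gcongr
      · exact hfin.ne
      · exact game_le_serve x _

end JobModel

/-- A function of two variables that is measurable in the first one and monotone in the second one
is jointly measurable, up to null sets. -/
theorem aemeasurable_uncurry_of_monotone {α : Type*} [MeasurableSpace α] {ν : Measure α}
    [SFinite ν] {κ : Measure ℝ} [SFinite κ] [NullSingletonClass κ] {Φ : α → ℝ → ℝ≥0∞}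
    (hmono : ∀ a, Monotone (Φ a)) (hmeas : ∀ r, AEMeasurable (fun a => Φ a r) ν) :
    AEMeasurable (Function.uncurry Φ) (ν.prod κ) := by
  choose g hg hgΦ using fun q : ℚ => hmeas q
  -- Measurable envelopes built from the rational sections. For almost every `a` they enclose `Φ a`
  -- and coincide where `Φ a` is continuous, that is, off a countable set, which is null for the
  -- atomless `κ`.
  let lo : α × ℝ → ℝ≥0∞ := fun p => ⨆ q : ℚ, if (q : ℝ) < p.2 then g q p.1 else 0
  let hi : α × ℝ → ℝ≥0∞ := fun p => ⨅ q : ℚ, if p.2 < (q : ℝ) then g q p.1 else ∞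
  have hlo : Measurable lo := Measurable.iSup fun q =>
    Measurable.ite (measurableSet_lt measurable_const measurable_snd)
      ((hg q).comp measurable_fst) measurable_const
  have hhi : Measurable hi := Measurable.iInf fun q =>
    Measurable.ite (measurableSet_lt measurable_snd measurable_const)
      ((hg q).comp measurable_fst) measurable_const
  have hall : ∀ᵐ a ∂ν, ∀ q : ℚ, Φ a q = g q a := ae_all_iff.2 hgΦ
  have hloΦ {a : α} (ha : ∀ q : ℚ, Φ a q = g q a) (r : ℝ) : lo (a, r) ≤ Φ a r := by
    refine iSup_le fun q => ?_
    simp only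
    split_ifs with h
    · exact ha q ▸ hmono a h.le
    · exact zero_le
  have hΦhi {a : α} (ha : ∀ q : ℚ, Φ a q = g q a) (r : ℝ) : Φ a r ≤ hi (a, r) := by
    refine le_iInf fun q => ?_
    simp only
    split_ifs with h
    · exact ha q ▸ hmono a h.le
    · exact le_top
  have heq : ∀ᵐ p ∂(ν.prod κ), lo p = hi p := by
    refine (Measure.ae_prod_iff_ae_ae (measurableSet_eq_fun hlo hhi)).2 ?_
    filter_upwards [hall] with a ha
    have hc : ∀ᵐ r ∂κ, ContinuousAt (Φ a) r :=
      measure_mono_null (fun r hr => hr) ((hmono a).countable_not_continuousAt.measure_zero κ)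
    filter_upwards [hc] with r hr
    refine le_antisymm ((hloΦ ha r).trans (hΦhi ha r)) ?_
    refine le_trans (b := Φ a r) ?_ ?_
    · refine ge_of_tendsto (hr.tendsto.mono_left (nhdsWithin_le_nhds (s := Ioi r))) ?_
      filter_upwards [self_mem_nhdsWithin] with u (hu : r < u)
      obtain ⟨q, h1, h2⟩ := exists_rat_btwn hu
      refine (iInf_le _ q).trans ?_
      simp only [if_pos h1]
      exact ha q ▸ hmono a h2.le
    · refine le_of_tendsto (hr.tendsto.mono_left (nhdsWithin_le_nhds (s := Iio r))) ?_
      filter_upwards [self_mem_nhdsWithin] with u (hu : u < r)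
      obtain ⟨q, h1, h2⟩ := exists_rat_btwn hu
      refine le_trans ?_ (le_iSup _ q)
      simp only [if_pos h2]
      exact ha q ▸ hmono a h1.le
  refine ⟨lo, hlo, ?_⟩
  filter_upwards [heq, Measure.quasiMeasurePreserving_fst.ae hall] with p hp hq
  exact le_antisymm ((hΦhi hq p.2).trans_eq hp.symm) (hloΦ hq p.2)

/-! ### Mean work of a list of states and averaging over the equilibrium law -/

namespace JobModel

variable {E : Type*} [TopologicalSpace E] [TopologicalSpace.MetrizableSpace E]
  [MeasurableSpace E] [BorelSpace E] {M : JobModel E}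

/-- The mean of the preemptible `r`-work of a job in state `x`. -/
noncomputable def meanWork (M : JobModel E) (r : ℝ≥0) : E → ℝ≥0∞ :=
  M.preemptible.indicator fun x => M.serve x (M.optSet r)

theorem meanWork_mono (hM : M.GameSolvable) (x : E) : Monotone fun r => M.meanWork r x := by
  intro r s h
  exact indicator_le_indicator (serve_anti (optSet_anti hM h) x)

theorem aemeasurable_meanWork (hM : M.GameSolvable) (r : ℝ≥0) (μ : Measure E)
    [IsProbabilityMeasure μ] : AEMeasurable (M.meanWork r) μ :=
  ((hM.isGiveUpSet_optSet r).aemeasurable_serve μ).indicator M.measurableSet_preemptible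

/-- Means add under convolution of probability measures; total mass one is part of the induction
because the addition formula uses it. -/
theorem lintegral_preemptibleWorkDist (hM : M.GameSolvable) (r : ℝ≥0) (l : List E) :
    IsProbabilityMeasure (M.preemptibleWorkDist r l) ∧
      ∫⁻ w, w ∂(M.preemptibleWorkDist r l) = (l.map (M.meanWork r)).sum := by
  induction l with
  | nil => exact ⟨by unfold preemptibleWorkDist; infer_instance, by simp [preemptibleWorkDist]⟩
  | cons x l ih =>
    obtain ⟨h1, h2⟩ := ih
    have hent := (hM.isGiveUpSet_optSet r).aemeasurable_entry_law x
    have key (ρ : Measure ℝ≥0∞) (hρ : IsProbabilityMeasure ρ) :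
        IsProbabilityMeasure (ρ.conv (M.preemptibleWorkDist r l)) ∧
        ∫⁻ w, w ∂(ρ.conv (M.preemptibleWorkDist r l)) =
          ∫⁻ w, w ∂ρ + ∫⁻ w, w ∂(M.preemptibleWorkDist r l) := by
      refine ⟨inferInstance, ?_⟩
      rw [Measure.lintegral_conv measurable_id']
      simp_rw [lintegral_add_left (measurable_const (α := ℝ≥0∞)), lintegral_const, measure_univ,
        mul_one]
      rw [lintegral_add_right _ measurable_const, lintegral_const, measure_univ, mul_one]
    rw [List.map_cons, List.sum_cons, ← h2, preemptibleWorkDist]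
    split_ifs with hx
    · have := Measure.isProbabilityMeasure_map hent
      refine ⟨(key _ this).1, (key _ this).2.trans ?_⟩
      rw [lintegral_map' aemeasurable_id' hent, meanWork, indicator_of_mem hx, serve]
    · refine ⟨(key _ inferInstance).1, (key _ inferInstance).2.trans ?_⟩
      rw [lintegral_dirac, meanWork, indicator_of_notMem hx]

end JobModel

/-- Padding with a point where `f` vanishes replaces a sum of variable length by a fixed countable
sum over coordinates, which reduces measurability on lists to measurability on `E`. -/
theorem List.sum_map_eq_tsum_getD {α : Type*} {f : α → ℝ≥0∞} {d : α} (hd : f d = 0)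
    (l : List α) : (l.map f).sum = ∑' i, f (l.getD i d) := by
  induction l with
  | nil => simp [hd]
  | cons x l ih =>
    have h := tsum_eq_zero_add' (f := fun i => f ((x :: l).getD i d)) ENNReal.summable
    simp only [List.getD_cons_zero, List.getD_cons_succ] at h
    rw [List.map_cons, List.sum_cons, ih, ← h]

theorem List.measurable_getD {α : Type*} [MeasurableSpace α] (i : ℕ) (d : α) :
    Measurable fun l : List α => l.getD i d := by
  intro A hA
  refine MeasurableSpace.measurableSet_iInf.2 fun n => ?_
  have h : Measurable fun v : Fin n → α => (List.ofFn v).getD i d := by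
    by_cases h : i < n
    · simp only [List.getD_eq_getElem?_getD, List.getElem?_ofFn, h, dite_true, Option.getD_some]
      exact measurable_pi_apply _
    · simp only [List.getD_eq_getElem?_getD, List.getElem?_ofFn, h, dite_false, Option.getD_none]
      exact measurable_const
  exact h hA

namespace JobModel

variable {E : Type*} [TopologicalSpace E] [TopologicalSpace.MetrizableSpace E]
  [MeasurableSpace E] [BorelSpace E] {M : JobModel E}

theorem preemptibleHoldCost_eq_lintegral (hM : M.GameSolvable)
    (hserve : ∀ x ∈ M.preemptible, M.serve x ∅ < ∞) (l : List E) :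
    M.preemptibleHoldCost l = ∫⁻ r in Ioi (0 : ℝ),
      (l.map (M.meanWork r.toNNReal)).sum * (ENNReal.ofReal (r ^ 2))⁻¹ := by
  unfold preemptibleHoldCost
  induction l with
  | nil => simp
  | cons x l ih =>
    simp only [List.map_cons, List.sum_cons, add_mul]
    rw [lintegral_add_left, ih]
    · congr 1
      split_ifs with hx
      · rw [holdCost_eq_lintegral hM hx (hserve x hx)]
        simp [meanWork, hx, div_eq_mul_inv]
      · simp [meanWork, hx]
    · have h : Monotone fun r : ℝ => M.meanWork r.toNNReal x :=
        (meanWork_mono hM x).comp fun _ _ => Real.toNNReal_mono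
      exact h.measurable.mul (by fun_prop)

theorem lintegral_preemptibleHoldCost (hM : M.GameSolvable)
    (hserve : ∀ x ∈ M.preemptible, M.serve x ∅ < ∞) (ν : Measure (List E))
    [IsProbabilityMeasure ν] :
    ∫⁻ l, M.preemptibleHoldCost l ∂ν = ∫⁻ r in Ioi (0 : ℝ),
      (∫⁻ l, ∫⁻ w, w ∂(M.preemptibleWorkDist r.toNNReal l) ∂ν) / ENNReal.ofReal (r ^ 2) := by
  have hmeas (r : ℝ≥0) : AEMeasurable (fun l => (l.map (M.meanWork r)).sum) ν := by
    simp_rw [List.sum_map_eq_tsum_getD (f := M.meanWork r) (indicator_of_notMem M.done_notMem _)]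
    refine AEMeasurable.tsum fun i => ?_
    have hi := List.measurable_getD i M.done
    have := Measure.isProbabilityMeasure_map (μ := ν) hi.aemeasurable
    -- The law of the `i`th entry, with `done` as padding, serves as the initial distribution of a
    -- job.
    exact (aemeasurable_meanWork hM r (ν.map _)).comp_measurable hi
  have hmono (l : List E) : Monotone fun r : ℝ => (l.map (M.meanWork r.toNNReal)).sum :=
    fun r s h => List.sum_le_sum fun x _ => meanWork_mono hM x (Real.toNNReal_mono h)
  have hjoint : AEMeasurable (Function.uncurry fun (l : List E) (r : ℝ) =>
      (l.map (M.meanWork r.toNNReal)).sum * (ENNReal.ofReal (r ^ 2))⁻¹)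
      (ν.prod (volume.restrict (Ioi 0))) :=
    (aemeasurable_uncurry_of_monotone hmono fun r => hmeas r.toNNReal).mul
      (by fun_prop : Measurable fun p : List E × ℝ => (ENNReal.ofReal (p.2 ^ 2))⁻¹).aemeasurable
  simp_rw [preemptibleHoldCost_eq_lintegral hM hserve]
  -- Tonelli's theorem, applied to the formula that holds for each list.
  rw [lintegral_lintegral_swap hjoint]
  refine lintegral_congr fun r => ?_
  simp_rw [fun l => (lintegral_preemptibleWorkDist hM r.toNNReal l).2]
  rw [lintegral_mul_const'' _ (hmeas _), div_eq_mul_inv]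

end JobModel

theorem mainTheorem3 {E : Type*} [TopologicalSpace E] [TopologicalSpace.MetrizableSpace E]
    [MeasurableSpace E] [BorelSpace E] (M : JobModel E) (hM : M.GameSolvable)
    (hserve : ∀ x ∈ M.preemptible, M.serve x ∅ < ∞) :
    (∀ x ∈ M.preemptible,
      ConcaveOn ℝ (Ici 0) (fun r : ℝ => (M.game x r.toNNReal).toReal) ∧
      (∀ᵐ r ∂(volume.restrict (Ioi (0 : ℝ))),
        HasDerivAt (fun u : ℝ => (M.game x u.toNNReal).toReal)
          (M.hold x (M.optSet r.toNNReal)).toReal r) ∧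
      (M.holdCost x : ℝ≥0∞) =
        ∫⁻ r in Ioi (0 : ℝ), M.serve x (M.optSet r.toNNReal) / ENNReal.ofReal (r ^ 2)) ∧
    (∀ Q : QueueModel E, Q.job = M → Q.load < 1 →
      ∀ π : SchedulingPolicy E, π.IsNonclairvoyant →
      ∀ (Ω : Type*) [MeasurableSpace Ω] (P : Measure Ω) [IsProbabilityMeasure P]
        (R : QueueEvolution E Ω), R.IsEvolutionUnder Q π P →
      ∀ (ν : Measure (List E)) [IsProbabilityMeasure ν], R.IsEquilibrium M P ν →
        ∫⁻ l, M.preemptibleHoldCost l ∂ν =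
          ∫⁻ r in Ioi (0 : ℝ),
            (∫⁻ l, ∫⁻ w, w ∂(M.preemptibleWorkDist r.toNNReal l) ∂ν) /
              ENNReal.ofReal (r ^ 2)) := by
  refine ⟨fun x hx => ⟨JobModel.concaveOn_game (hserve x hx), JobModel.ae_hasDerivAt_game hM hx (hserve x hx),
    JobModel.holdCost_eq_lintegral hM hx (hserve x hx)⟩, ?_⟩
  intro Q _ _ π _ Ω _ P _ R _ ν _ _
  exact JobModel.lintegral_preemptibleHoldCost hM hserve ν
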